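/- Let $N\in\mathbb{N}$, $\chi>0$ and, for $\ell=1,\dots,N$, let $m^\ell>0$, $q^\ell\in\mathbb{R}$, $a^\ell>0$. Put $C_g=\pi^{-3/4}$ and let $$G_\ell(s)=\int_0^s\Big[-(a^\ell)^{-2}\ln\big((a^\ell)^3 s'/C_g^2\big)-3(a^\ell)^{-2}\Big]\,ds'=-(a^\ell)^{-2}\,s\ln\big((a^\ell)^3 s/C_g^2\big)-2(a^\ell)^{-2}s,\qquad G_\ell(0)=0 .$$ Let $\Xi=\{\psi\in H^1(\mathbb{R}^3;\mathbb{C}):\int|\psi|^2\,dx=1\}$ and, for $\psi=(\psi_1,\dots,\psi_N)\in\Xi^N$, let $$\varphi_{\ell}(x)=q^{\ell}\int_{\mathbb{R}^3}\frac{|\psi_\ell(y)|^2}{|y-x|}\,dy,\qquad \varphi_{\neq\ell}=\sum_{\ell'\neq\ell}\varphi_{\ell'},$$ $$\mathcal{E}(\psi)=\sum_{\ell=1}^N\Big[\tfrac12\int q^\ell|\psi_\ell|^2\varphi_{\neq\ell}\,dx+\int\frac{\chi^2}{2m^\ell}\big\{|\nabla\psi_\ell|^2+G_\ell(|\psi_\ell|^2)\big\}\,dx\Big],$$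 $$\mathsf{E}_{0\ell}(\psi)=\int q^\ell|\psi_\ell|^2\varphi_{\neq\ell}\,dx+\int\frac{\chi^2}{2m^\ell}\big\{|\nabla\psi_\ell|^2+G_\ell(|\psi_\ell|^2)\big\}\,dx .$$ Let $A(s)=-s^2\ln s^2$ for $0\le s\le e^{-3}$ (with $A(0)=0$) and $A(s)=3s^2+4e^{-3}s-e^{-6}$ for $s\ge e^{-3}$, let $X=\{u\in L^1_{\mathrm{loc}}(\mathbb{R}^3):A(|u|)\in L^1(\mathbb{R}^3)\}$ with the Luxemburg norm $\|u\|_X=\inf\{k>0:\int A(|u|/k)\,dx\le1\}$, and let $\|u\|_{H^1}^2=\int|u|^2\,dx+\int|\nabla u|^2\,dx$. Then: (0) For $\psi\in\Xi^N$ the integrals that define the potentials $\varphi_\ell(x)$ (for every $x$) and the interaction terms converge absolutely, and the negative parts of $|\nabla\psi_\ell|^2+G_\ell(|\psi_\ell|^2)$ are integrable. Hence $\mathcal{E}$ and all $\mathsf{E}_{0\ell}$ are well defined on $\Xi^N$, with values in $(-\infty,\infty]$. (1) $\mathcal{E}$ is bounded from below on $\Xi^N$. (2) For every $M\in\mathbb{R}$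 there is a constant $C$ (depending only on $M$, $N$, $\chi$ and the $m^\ell,q^\ell,a^\ell$) such that for all $\psi\in\Xi^N$ with $\mathcal{E}(\psi)\le M$ one has $\psi_\ell\in X$, $\|\psi_\ell\|_{H^1}\le C$ and $\|\psi_\ell\|_X\le C$ for every $\ell=1,\dots,N$. (3) The same conclusion holds, with a constant of the same kind, for all $\psi\in\Xi^N$ with $\mathsf{E}_{0\ell}(\psi)\le M$ for every $\ell=1,\dots,N$. -/

import Mathlib

open MeasureTheory
open scoped ENNReal SchwartzMap LineDeriv

noncomputable section

namespace WaveCorpuscle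

/-- Euclidean space `ℝ³`. -/
abbrev R3 := EuclideanSpace ℝ (Fin 3)

/-- Complex-valued `L²(ℝ³)` (almost everywhere equal functions are identified). -/
abbrev L2 := Lp ℂ 2 (volume : Measure R3)

/-- Membership in `H¹(ℝ³)`. -/
def MemH1 (ψ : L2) : Prop :=
  TemperedDistribution.MemSobolev 1 2 (ψ : 𝓢'(R3, ℂ))

/-- The `i`-th coordinate unit vector of `ℝ³`. -/
def coordVec (i : Fin 3) : R3 := EuclideanSpace.single i 1

/-- The distributional partial derivatives of an `H¹` function are in `L²`. -/
theorem MemH1.exists_partial {ψ : L2} (h : MemH1 ψ) (i : Fin 3) :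
    ∃ g : L2, ∂_{coordVec i} (ψ : 𝓢'(R3, ℂ)) = (g : 𝓢'(R3, ℂ)) := by
  have h1 := TemperedDistribution.MemSobolev.lineDerivOp (m := coordVec i) h
  rw [sub_self] at h1
  exact TemperedDistribution.memSobolev_zero_iff.mp h1

open Classical in
/-- The partial derivative `∂ᵢψ` as an `L²` function: the `L²` function that represents the
distributional derivative (it exists for every `ψ ∈ H¹`; the value is `0` if there is none). -/
def partialDeriv (ψ : L2) (i : Fin 3) : L2 :=
  if h : ∃ g : L2, ∂_{coordVec i} (ψ : 𝓢'(R3, ℂ)) = (g : 𝓢'(R3, ℂ)) then h.choose else 0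

/-- For `ψ ∈ H¹`, `partialDeriv ψ i` is the distributional derivative of `ψ`. -/
theorem MemH1.partialDeriv_spec {ψ : L2} (h : MemH1 ψ) (i : Fin 3) :
    ∂_{coordVec i} (ψ : 𝓢'(R3, ℂ)) = (partialDeriv ψ i : 𝓢'(R3, ℂ)) := by
  unfold partialDeriv
  rw [dif_pos (h.exists_partial i)]
  exact (h.exists_partial i).choose_spec

/-- `|∇ψ(x)|²`. -/
def gradSq (ψ : L2) (x : R3) : ℝ := ∑ i : Fin 3, ‖partialDeriv ψ i x‖ ^ 2

/-- The norm `‖ψ‖_{H¹} = (∫ |ψ|² + ∫ |∇ψ|²)^{1/2}`. -/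
def normH1 (ψ : L2) : ℝ := Real.sqrt ((∫ x, ‖ψ x‖ ^ 2) + ∫ x, gradSq ψ x)

/-- `Ξ = {ψ ∈ H¹(ℝ³) : ∫ |ψ|² = 1}`. -/
def Xi : Set L2 := {ψ | MemH1 ψ ∧ ∫ x, ‖ψ x‖ ^ 2 = 1}

/-- `C_g = π^{-3/4}`. -/
def Cg : ℝ := 1 / Real.pi ^ (3 / 4 : ℝ)

/-- `G_a'(s) = -a⁻² ln (a³ s / C_g²) - 3 a⁻²`. -/
def logGDeriv (a s : ℝ) : ℝ := -(a ^ 2)⁻¹ * Real.log (a ^ 3 * s / Cg ^ 2) - 3 * (a ^ 2)⁻¹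

/-- The logarithmic nonlinearity with size parameter `a`: the primitive of `logGDeriv a` that
vanishes at `0`. -/
def logG (a s : ℝ) : ℝ :=
  -(a ^ 2)⁻¹ * (s * Real.log (a ^ 3 * s / Cg ^ 2)) - 2 * (a ^ 2)⁻¹ * s

theorem logG_zero (a : ℝ) : logG a 0 = 0 := by simp [logG]

theorem hasDerivAt_logG {a s : ℝ} (ha : 0 < a) (hs : 0 < s) :
    HasDerivAt (logG a) (logGDeriv a s) s := by
  have hC : 0 < Cg := by unfold Cg; positivity
  have h1 : HasDerivAt (fun s : ℝ => a ^ 3 * s / Cg ^ 2) (a ^ 3 / Cg ^ 2) s := by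
    simpa using ((hasDerivAt_id s).const_mul (a ^ 3)).div_const (Cg ^ 2)
  have h2 := h1.log (by positivity)
  have h3 := (((hasDerivAt_id s).mul h2).const_mul (-(a ^ 2)⁻¹)).sub
    ((hasDerivAt_id s).const_mul (2 * (a ^ 2)⁻¹))
  refine h3.congr_deriv ?_
  simp only [id, logGDeriv]
  field_simp
  ring

/-- The integral over `ℝ³` with values in `[-∞, ∞]`, namely `∫ f⁺ - ∫ f⁻`. If both parts are
infinite, the value is `-∞`. -/
def eintegral (f : R3 → ℝ) : EReal :=
  ((∫⁻ x, ENNReal.ofReal (f x) : ℝ≥0∞) : EReal) -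
    ((∫⁻ x, ENNReal.ofReal (-f x) : ℝ≥0∞) : EReal)

/-- The potential `φ(x) = q ∫ |ψ(y)|² / |y - x| dy` of a charge `q` with wave function `ψ`. -/
def potential (q : ℝ) (ψ : L2) (x : R3) : ℝ := q * ∫ y, ‖ψ y‖ ^ 2 / ‖y - x‖

variable {N : ℕ}

/-- `φ_{≠ℓ} = ∑_{ℓ' ≠ ℓ} φ^{ℓ'}`. -/
def potentialNe (q : Fin N → ℝ) (ψ : Fin N → L2) (l : Fin N) (x : R3) : ℝ :=
  ∑ k ∈ Finset.univ.erase l, potential (q k) (ψ k) x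

/-- The integrand `q^ℓ |ψ^ℓ|² φ_{≠ℓ}` of the interaction term. -/
def interactionDensity (q : Fin N → ℝ) (ψ : Fin N → L2) (l : Fin N) (x : R3) : ℝ :=
  q l * ‖ψ l x‖ ^ 2 * potentialNe q ψ l x

/-- The integrand `χ²/(2m) (|∇ψ|² + G_a(|ψ|²))` of the free energy. -/
def freeDensity (χ m a : ℝ) (ψ : L2) (x : R3) : ℝ :=
  χ ^ 2 / (2 * m) * (gradSq ψ x + logG a (‖ψ x‖ ^ 2))

/-- The energy `𝓔_ℓ`. -/
def energyPart (χ : ℝ) (m q a : Fin N → ℝ) (ψ : Fin N → L2) (l : Fin N) : EReal :=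
  (((1 / 2 : ℝ) * ∫ x, interactionDensity q ψ l x : ℝ) : EReal) +
    eintegral (freeDensity χ (m l) (a l) (ψ l))

/-- The total energy `𝓔 = ∑_ℓ 𝓔_ℓ`. -/
def totalEnergy (χ : ℝ) (m q a : Fin N → ℝ) (ψ : Fin N → L2) : EReal :=
  ∑ l, energyPart χ m q a ψ l

/-- The energy `𝖤_{0ℓ}` of the `ℓ`-th charge in the field of the system. -/
def energyInField (χ : ℝ) (m q a : Fin N → ℝ) (ψ : Fin N → L2) (l : Fin N) : EReal :=
  ((∫ x, interactionDensity q ψ l x : ℝ) : EReal) +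
    eintegral (freeDensity χ (m l) (a l) (ψ l))

/-- The convex function `A` on `[0, ∞)` that defines the Orlicz space `X`. -/
def orliczA (s : ℝ) : ℝ :=
  if s ≤ Real.exp (-3) then -(s ^ 2 * Real.log (s ^ 2))
  else 3 * s ^ 2 + 4 * Real.exp (-3) * s - Real.exp (-6)

/-- `X = {u ∈ L¹_loc(ℝ³) : A(|u|) ∈ L¹(ℝ³)}`. -/
def orliczX : Set (R3 → ℂ) := {u | LocallyIntegrable u ∧ Integrable fun x => orliczA ‖u x‖}

/-- The Luxemburg norm `‖u‖_X = inf {k > 0 : ∫ A(|u|/k) ≤ 1}` (`∞` if there is no such `k`). -/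
def normX (u : R3 → ℂ) : ℝ≥0∞ :=
  ⨅ (k : ℝ) (_ : 0 < k) (_ : ∫⁻ x, ENNReal.ofReal (orliczA (‖u x‖ / k)) ≤ 1), ENNReal.ofReal k

end WaveCorpuscle

end

open WaveCorpuscle

/-!
All negative contributions to the energies are controlled by `Q = ∫ |ψ|^{13/4}`, and `Q` is
controlled by an arbitrarily small multiple of `K = ∫ |∇ψ|²`.

*The inequality `Q ≤ δ K + C_δ`* (`exists_forall_integral_rpow_le`). Split `ψ` at a frequency `R`.
The low-frequency part has an integrable Fourier transform, hence is bounded by a multiple of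
`R^{3/2}`; by Plancherel the high-frequency part has squared norm at most `K / (4 π² R²)`. Hence the
integral of `|ψ|²` over the set where `|ψ|` exceeds twice the bound of the low part is at most
`K / R²` (`setLIntegral_enorm_sq_le_of_lt_norm`). The levels `t ~ R^{3/2}` give the decay
`t^{-4/3}`, which beats the weight `t^{5/4}`, and a dyadic sum over levels yields the inequality.

*Coulomb terms* (`coulomb_integrable_and_le`). Within unit distance `r` of the singularity,
`|ψ|² / r` is at most `|ψ|^{13/4} + r^{-13/5}`, and the last power is integrable over the unit ball
of `ℝ³`. So the potentials are bounded uniformly in space by a multiple of `1 + Q`.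

*Logarithmic terms* (`logG_sq_ge`). `|ψ|² log⁺ |ψ|²` is at most `(8/5) |ψ|^{13/4}`, so the free
energy is bounded below by a positive combination of `K` and the entropy `L = ∫ |ψ|² log⁻ |ψ|²`, up
to a multiple of `1 + Q`.

Absorbing `Q` into half of `K`, the sum of the energies is bounded below by a positive combination
of all `K` and `L` minus a constant (`exists_sum_energy_ge`). This gives the lower bound and, when
the energy is bounded, bounds on `K` and `L`. A bound on `L` bounds the Luxemburg norm: the Orlicz
function satisfies `A(s / k) ≤ k⁻² ((7 + 2 log k) s² + s² log⁻ s²)` for `k ≥ 1`, so that `k = 7 + L`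
is admissible (`mem_orliczX_and_normX_le`). Bounds on each of the energies in the field bound their
sum, to which the same estimate applies.
-/

noncomputable section

namespace WaveCorpuscle

open FourierTransform Real

/-! ### Fourier transform of square-integrable functions -/

/-- Locally integrable functions that agree as functionals on Schwartz functions agree almost
everywhere. This turns identities of tempered distributions into identities of functions. -/
theorem ae_eq_of_integral_schwartz_smul_eq {f g : R3 → ℂ} (hf : LocallyIntegrable f)
    (hg : LocallyIntegrable g)
    (h : ∀ u : 𝓢(R3, ℂ), ∫ x, u x • f x = ∫ x, u x • g x) : f =ᵐ[volume] g := by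
  refine ae_eq_of_integral_contDiff_smul_eq hf hg fun v hv hvc ↦ ?_
  have hc : HasCompactSupport (Complex.ofRealCLM ∘ v) := hvc.comp_left rfl
  have hs : ContDiff ℝ ((⊤ : ℕ∞) : WithTop ℕ∞) (Complex.ofRealCLM ∘ v) :=
    Complex.ofRealCLM.contDiff.comp hv
  simpa using h (hc.toSchwartzMap hs)

theorem lintegral_enorm_sq (f : L2) : ∫⁻ x, ‖f x‖ₑ ^ 2 = ‖f‖ₑ ^ 2 := by
  rw [Lp.enorm_def, eLpNorm_eq_lintegral_rpow_enorm_toReal (by norm_num) (by norm_num)]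
  rw [← ENNReal.rpow_natCast _ 2, ← ENNReal.rpow_mul]
  norm_num

theorem locallyIntegrable_coeFn (f : L2) : LocallyIntegrable (f : R3 → ℂ) :=
  (Lp.memLp f).locallyIntegrable (by norm_num)

theorem lintegral_enorm_sq_fourier (f : L2) :
    ∫⁻ x, ‖(𝓕 f : L2) x‖ₑ ^ 2 = ∫⁻ x, ‖f x‖ₑ ^ 2 := by
  rw [lintegral_enorm_sq, lintegral_enorm_sq, ← ofReal_norm, ← ofReal_norm, Lp.norm_fourier_eq]

/-- Differentiation becomes multiplication by `2πi ξᵢ` under the Fourier transform on `L²`. -/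
theorem fourier_partialDeriv_ae {ψ : L2} (h : MemH1 ψ) (i : Fin 3) :
    ((𝓕 (partialDeriv ψ i) : L2) : R3 → ℂ) =ᵐ[volume]
      fun ξ ↦ (2 * π * Complex.I) * ((ξ i : ℝ) * (𝓕 ψ : L2) ξ) := by
  have hloc : LocallyIntegrable
      (fun ξ : R3 ↦ (2 * π * Complex.I) * (((ξ i : ℝ) : ℂ) * (𝓕 ψ : L2) ξ)) := by
    have h1 : Continuous fun ξ : R3 ↦ (2 * π * Complex.I) * ((ξ i : ℝ) : ℂ) := by fun_prop
    have := (locallyIntegrable_coeFn (𝓕 ψ)).locallyIntegrableOn Set.univ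
    have h2 := this.continuousOn_mul h1.continuousOn isOpen_univ.isLocallyClosed
    rw [locallyIntegrableOn_univ] at h2
    simpa [mul_assoc] using h2
  refine ae_eq_of_integral_schwartz_smul_eq (locallyIntegrable_coeFn _) hloc fun u ↦ ?_
  have hT : (fun x : R3 ↦ ((inner ℝ x (coordVec i) : ℝ) : ℂ)).HasTemperateGrowth := by fun_prop
  have e1 : 𝓕 (∂_{coordVec i} (ψ : 𝓢'(R3, ℂ))) u = ∫ x, u x • (𝓕 (partialDeriv ψ i) : L2) x := by
    rw [h.partialDeriv_spec i, Lp.fourier_toTemperedDistribution_eq,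
      Lp.toTemperedDistribution_apply]
  rw [← e1, TemperedDistribution.fourier_lineDerivOp_eq, Lp.fourier_toTemperedDistribution_eq]
  change (2 * π * Complex.I) • (TemperedDistribution.smulLeftCLM ℂ _ _) u = _
  rw [TemperedDistribution.smulLeftCLM_apply_apply, Lp.toTemperedDistribution_apply,
    ← integral_smul]
  refine integral_congr_ae (.of_forall fun x ↦ ?_)
  simp only [SchwartzMap.smulLeftCLM_apply_apply hT, smul_eq_mul]
  have : inner ℝ x (coordVec i) = x i := by
    simp [coordVec, EuclideanSpace.inner_single_right]
  rw [this]; ring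

/-- Plancherel's theorem for the gradient. -/
theorem lintegral_norm_sq_mul_fourier {ψ : L2} (h : MemH1 ψ) :
    ENNReal.ofReal (4 * π ^ 2) * ∫⁻ ξ, ‖ξ‖ₑ ^ 2 * ‖(𝓕 ψ : L2) ξ‖ₑ ^ 2 =
      ∫⁻ x, ENNReal.ofReal (gradSq ψ x) := by
  have e1 : ∀ x, ENNReal.ofReal (gradSq ψ x) = ∑ i, ‖partialDeriv ψ i x‖ₑ ^ 2 := fun x ↦ by
    rw [gradSq, ENNReal.ofReal_sum_of_nonneg fun i _ ↦ by positivity]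
    refine Finset.sum_congr rfl fun i _ ↦ ?_
    rw [ENNReal.ofReal_pow (norm_nonneg _), ofReal_norm]
  simp_rw [e1]
  rw [lintegral_finsetSum' _ fun i _ ↦ (Lp.aestronglyMeasurable _).enorm.pow_const 2]
  simp_rw [← lintegral_enorm_sq_fourier (partialDeriv ψ _)]
  rw [← lintegral_finsetSum' _ fun i _ ↦ (Lp.aestronglyMeasurable _).enorm.pow_const 2,
    ← lintegral_const_mul' _ _ ENNReal.ofReal_ne_top]
  refine lintegral_congr_ae ?_
  filter_upwards [ae_all_iff.2 fun i ↦ fourier_partialDeriv_ae h i] with ξ hξ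
  simp_rw [hξ, ← ofReal_norm, ← ENNReal.ofReal_pow (norm_nonneg _)]
  rw [← ENNReal.ofReal_mul (by positivity), ← ENNReal.ofReal_mul (by positivity),
    ← ENNReal.ofReal_sum_of_nonneg fun i _ ↦ by positivity]
  congr 1
  simp only [norm_mul, Complex.norm_I, Complex.norm_real, Complex.norm_ofNat, mul_pow,
    EuclideanSpace.norm_sq_eq, norm_eq_abs, sq_abs, Finset.sum_mul, Finset.mul_sum]
  refine Finset.sum_congr rfl fun i _ ↦ by ring

/-- If the Fourier transform of an `L²` function is integrable, then the function is bounded by the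
`L¹` norm of the transform, because the inversion integral represents it almost everywhere. -/
theorem enorm_fourierInv_le_lintegral (f : L2) (hf : Integrable (f : R3 → ℂ)) :
    ∀ᵐ x, ‖(𝓕⁻ f : L2) x‖ₑ ≤ ∫⁻ ξ, ‖f ξ‖ₑ := by
  have hbd : ∀ x, ‖𝓕⁻ (f : R3 → ℂ) x‖ₑ ≤ ∫⁻ ξ, ‖f ξ‖ₑ := fun x ↦ by
    rw [Real.fourierInv_eq]
    refine (enorm_integral_le_lintegral_enorm _).trans_eq (lintegral_congr fun v ↦ ?_)
    rw [← ofReal_norm, ← ofReal_norm, Circle.norm_smul]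
  have hc : Continuous fun p : R3 × R3 ↦ (-innerₗ R3) p.1 p.2 := by
    simp only [LinearMap.neg_apply, innerₗ_apply_apply]
    fun_prop
  have hcont : Continuous (𝓕⁻ (f : R3 → ℂ)) :=
    VectorFourier.fourierIntegral_continuous (L := -innerₗ R3) continuous_fourierChar hc hf
  have key : ((𝓕⁻ f : L2) : R3 → ℂ) =ᵐ[volume] 𝓕⁻ (f : R3 → ℂ) := by
    refine ae_eq_of_integral_schwartz_smul_eq (locallyIntegrable_coeFn _)
      hcont.locallyIntegrable fun u ↦ ?_
    rw [← Lp.toTemperedDistribution_apply, ← Lp.fourierInv_toTemperedDistribution_eq,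
      TemperedDistribution.fourierInv_apply, Lp.toTemperedDistribution_apply]
    have := VectorFourier.integral_fourierIntegral_smul_eq_flip (L := -innerₗ R3)
      (μ := volume) (ν := volume) continuous_fourierChar hc u.integrable hf
    rw [SchwartzMap.fourierInv_coe]
    have hfl : (-innerₗ R3).flip = -innerₗ R3 := by
      ext x y; simp [real_inner_comm]
    rw [hfl] at this
    exact this
  filter_upwards [key] with x hx
  rw [hx]; exact hbd x

/-! ### Distribution of large values of `H¹` functions -/

theorem integrable_norm_sq (f : L2) : Integrable fun x ↦ ‖f x‖ ^ 2 :=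
  (Lp.memLp f).integrable_norm_pow (by norm_num)

theorem lintegral_enorm_sq_eq_one {ψ : L2} (h : ψ ∈ Xi) : ∫⁻ x, ‖ψ x‖ₑ ^ 2 = 1 := by
  have := ofReal_integral_eq_lintegral_ofReal (integrable_norm_sq ψ)
    (.of_forall fun x ↦ by positivity)
  rw [h.2, ENNReal.ofReal_one] at this
  rw [this]
  refine lintegral_congr fun x ↦ ?_
  rw [ENNReal.ofReal_pow (norm_nonneg _), ofReal_norm]

/-- The low-frequency part is bounded by the square root of the volume of the frequency ball, and
the high-frequency part is small in `L²` by the gradient bound. Where `|ψ|` exceeds twice the bound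
of the former, it is at most twice the latter. The frequency radius is written as `ρ ^ 8`, so that
the level `(2 ρ³)⁴` and its power `5/4` are polynomials in `ρ`. -/
theorem setLIntegral_enorm_sq_le_of_lt_norm {ψ : L2} (h : ψ ∈ Xi) {ρ : ℝ} (hρ : 0 < ρ) :
    ∫⁻ x in {x | (2 * ρ ^ 3) ^ 4 < ‖ψ x‖}, ‖ψ x‖ₑ ^ 2 ≤
      ENNReal.ofReal (ρ ^ 16)⁻¹ * ∫⁻ x, ENNReal.ofReal (gradSq ψ x) := by
  set E := ∫⁻ x, ENNReal.ofReal (gradSq ψ x) with hE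
  set g : L2 := 𝓕 ψ with hg
  set S : Set R3 := Metric.ball 0 (ρ ^ 8) with hS
  have hSm : MeasurableSet S := measurableSet_ball
  have hl := (Lp.memLp g).indicator hSm
  have hh := (Lp.memLp g).indicator hSm.compl
  set gl : L2 := hl.toLp _ with hgl
  set gh : L2 := hh.toLp _ with hgh
  have hsum : ψ = 𝓕⁻ gl + 𝓕⁻ gh := by
    rw [← FourierInvAdd.fourierInv_add, hgl, hgh, ← MemLp.toLp_add hl hh]
    have : MemLp.toLp _ (hl.add hh) = g := by
      refine Lp.ext ((MemLp.coeFn_toLp _).trans ?_)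
      rw [Set.indicator_self_add_compl]
    rw [this, hg, FourierPair.fourierInv_fourier_eq]
  have hg1 : ‖g‖ₑ = 1 := by
    have h1 := lintegral_enorm_sq_eq_one h
    rw [← lintegral_enorm_sq_fourier, lintegral_enorm_sq] at h1
    rw [← ofReal_norm, ← ENNReal.ofReal_pow (norm_nonneg _), ENNReal.ofReal_eq_one,
      pow_eq_one_iff_of_nonneg (norm_nonneg _) two_ne_zero] at h1
    rw [← ofReal_norm, h1, ENNReal.ofReal_one]
  -- half of the level `(2 ρ³)⁴` bounds the square root of the volume of the frequency ball
  have hvol : (volume S) ^ (1 / 2 : ℝ) ≤ ENNReal.ofReal (8 * ρ ^ 12) := by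
    rw [one_div, ENNReal.rpow_inv_le_iff (by norm_num), hS, EuclideanSpace.volume_ball_fin_three,
      ← ENNReal.ofReal_pow (by positivity), ← ENNReal.ofReal_mul (by positivity)]
    rw [ENNReal.rpow_ofNat, ← ENNReal.ofReal_pow (by positivity)]
    refine ENNReal.ofReal_le_ofReal ?_
    have := pi_le_four
    calc (ρ ^ 8) ^ 3 * (π * 4 / 3) ≤ (ρ ^ 8) ^ 3 * 64 := by gcongr; linarith
      _ = _ := by ring
  have hgl_int : ∫⁻ ξ, ‖gl ξ‖ₑ ≤ ENNReal.ofReal (8 * ρ ^ 12) := by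
    calc ∫⁻ ξ, ‖gl ξ‖ₑ = ∫⁻ ξ in S, ‖g ξ‖ₑ := by
          rw [← lintegral_indicator hSm]
          refine lintegral_congr_ae ?_
          filter_upwards [hl.coeFn_toLp] with ξ hξ
          rw [hgl, hξ, enorm_indicator_eq_indicator_enorm]
      _ = eLpNorm g 1 (volume.restrict S) := eLpNorm_one_eq_lintegral_enorm.symm
      _ ≤ eLpNorm g 2 (volume.restrict S) * (volume.restrict S) Set.univ ^
            (1 / (1 : ℝ≥0∞).toReal - 1 / (2 : ℝ≥0∞).toReal) :=
          eLpNorm_le_eLpNorm_mul_rpow_measure_univ (by norm_num)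
            (Lp.aestronglyMeasurable g).restrict
      _ ≤ 1 * ENNReal.ofReal (8 * ρ ^ 12) := by
          gcongr
          · rw [← hg1, Lp.enorm_def]; exact eLpNorm_restrict_le _ _ _ _
          · rw [Measure.restrict_apply_univ]; norm_num at hvol ⊢; exact hvol
      _ = _ := one_mul _
  have hgl_integrable : Integrable (gl : R3 → ℂ) :=
    ⟨Lp.aestronglyMeasurable _, hgl_int.trans_lt ENNReal.ofReal_lt_top⟩
  have hlow := enorm_fourierInv_le_lintegral gl hgl_integrable
  have hpt : ∀ᵐ x, x ∈ {x | (2 * ρ ^ 3) ^ 4 < ‖ψ x‖} →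
      ‖ψ x‖ₑ ^ 2 ≤ 4 * ‖(𝓕⁻ gh : L2) x‖ₑ ^ 2 := by
    have hadd : (ψ : R3 → ℂ) =ᵐ[volume] (𝓕⁻ gl : L2) + (𝓕⁻ gh : L2) := by
      conv_lhs => rw [hsum]
      exact Lp.coeFn_add _ _
    filter_upwards [hlow, hadd] with x hx1 hx2 hx3
    have h1 : ‖(𝓕⁻ gl : L2) x‖ ≤ 8 * ρ ^ 12 := by
      have := hx1.trans hgl_int
      rwa [← ofReal_norm, ENNReal.ofReal_le_ofReal_iff (by positivity)] at this
    have h2 : ‖ψ x‖ ≤ ‖(𝓕⁻ gl : L2) x‖ + ‖(𝓕⁻ gh : L2) x‖ := by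
      rw [hx2]; exact norm_add_le _ _
    have h3 : (2 * ρ ^ 3) ^ 4 < ‖ψ x‖ := hx3
    have h4 : ‖ψ x‖ ≤ 2 * ‖(𝓕⁻ gh : L2) x‖ := by
      have : (2 * ρ ^ 3) ^ 4 = 2 * (8 * ρ ^ 12) := by ring
      linarith
    have h5 : ‖ψ x‖ ^ 2 ≤ 4 * ‖(𝓕⁻ gh : L2) x‖ ^ 2 := by
      calc _ ≤ (2 * ‖(𝓕⁻ gh : L2) x‖) ^ 2 := by gcongr
        _ = _ := by ring
    have h6 := ENNReal.ofReal_le_ofReal h5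
    rw [ENNReal.ofReal_mul (by norm_num), ENNReal.ofReal_pow (norm_nonneg _),
      ENNReal.ofReal_pow (norm_nonneg _), ofReal_norm, ofReal_norm] at h6
    simpa using h6
  have hms : MeasurableSet {x | (2 * ρ ^ 3) ^ 4 < ‖ψ x‖} :=
    measurableSet_lt measurable_const (Lp.stronglyMeasurable ψ).norm.measurable
  have hhigh : ENNReal.ofReal (ρ ^ 16) * ∫⁻ x, ‖gh x‖ₑ ^ 2 ≤ ∫⁻ ξ, ‖ξ‖ₑ ^ 2 * ‖g ξ‖ₑ ^ 2 := by
    rw [← lintegral_const_mul' _ _ ENNReal.ofReal_ne_top]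
    refine lintegral_mono_ae ?_
    filter_upwards [hh.coeFn_toLp] with ξ hξ
    rw [hgh, hξ]
    by_cases hm : ξ ∈ S
    · simp [hm]
    · rw [Set.indicator_of_mem (by exact hm)]
      gcongr
      have : ρ ^ 8 ≤ ‖ξ‖ := by simpa [hS] using hm
      rw [← ofReal_norm, ← ENNReal.ofReal_pow (norm_nonneg _)]
      refine ENNReal.ofReal_le_ofReal ?_
      calc ρ ^ 16 = (ρ ^ 8) ^ 2 := by ring
        _ ≤ _ := by gcongr
  calc ∫⁻ x in {x | (2 * ρ ^ 3) ^ 4 < ‖ψ x‖}, ‖ψ x‖ₑ ^ 2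
      ≤ ∫⁻ x in {x | (2 * ρ ^ 3) ^ 4 < ‖ψ x‖}, 4 * ‖(𝓕⁻ gh : L2) x‖ₑ ^ 2 :=
        setLIntegral_mono_ae' hms hpt
    _ ≤ ∫⁻ x, 4 * ‖(𝓕⁻ gh : L2) x‖ₑ ^ 2 := setLIntegral_le_lintegral _ _
    _ = 4 * ∫⁻ x, ‖gh x‖ₑ ^ 2 := by
        rw [lintegral_const_mul' _ _ (by norm_num), ← lintegral_enorm_sq_fourier (𝓕⁻ gh),
          FourierInvPair.fourier_fourierInv_eq]
    _ = ENNReal.ofReal (ρ ^ 16)⁻¹ * (4 * (ENNReal.ofReal (ρ ^ 16) * ∫⁻ x, ‖gh x‖ₑ ^ 2)) := by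
        have : ENNReal.ofReal (ρ ^ 16)⁻¹ * ENNReal.ofReal (ρ ^ 16) = 1 := by
          rw [← ENNReal.ofReal_mul (by positivity), inv_mul_cancel₀ (by positivity),
            ENNReal.ofReal_one]
        rw [← one_mul (4 * ∫⁻ x, ‖gh x‖ₑ ^ 2), ← this]; ring
    _ ≤ _ := by
        gcongr
        rw [hE, ← lintegral_norm_sq_mul_fourier h.1]
        refine mul_le_mul' ?_ hhigh
        have : (4 : ℝ≥0∞) = ENNReal.ofReal 4 := by simp
        rw [this]
        refine ENNReal.ofReal_le_ofReal ?_
        nlinarith [pi_gt_three]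

/-! ### A Gagliardo–Nirenberg inequality -/

theorem integrable_gradSq (ψ : L2) : Integrable (gradSq ψ) :=
  integrable_finsetSum _ fun i _ ↦ integrable_norm_sq (partialDeriv ψ i)

theorem gradSq_nonneg (ψ : L2) (x : R3) : 0 ≤ gradSq ψ x :=
  Finset.sum_nonneg fun i _ ↦ by positivity

theorem lintegral_ofReal_gradSq (ψ : L2) :
    ∫⁻ x, ENNReal.ofReal (gradSq ψ x) = ENNReal.ofReal (∫ x, gradSq ψ x) :=
  (ofReal_integral_eq_lintegral_ofReal (integrable_gradSq ψ)
    (.of_forall (gradSq_nonneg ψ))).symm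

theorem rpow_five_quarters {b : ℝ} (hb : 0 ≤ b) : (b ^ 4) ^ (5 / 4 : ℝ) = b ^ 5 := by
  rw [← rpow_natCast b 4, ← rpow_mul hb, ← rpow_natCast b 5]; norm_num

/-- Pointwise dyadic decomposition of the power `5/4` along the levels `(2 (2ⁿ ρ)³)⁴`. -/
theorem ofReal_rpow_le_tsum_indicator {s ρ : ℝ} (hs : 0 ≤ s) (hρ : 0 < ρ) :
    ENNReal.ofReal (s ^ (5 / 4 : ℝ)) ≤ ENNReal.ofReal (32 * ρ ^ 15) +
      ∑' n : ℕ, if (2 * (2 ^ n * ρ) ^ 3) ^ 4 < s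
        then ENNReal.ofReal (2 ^ 20 * (2 ^ n * ρ) ^ 15) else 0 := by
  set t : ℕ → ℝ := fun n ↦ (2 * (2 ^ n * ρ) ^ 3) ^ 4 with ht
  have htp : ∀ n, (t n) ^ (5 / 4 : ℝ) = 32 * (2 ^ n * ρ) ^ 15 := fun n ↦ by
    rw [ht]; dsimp only
    rw [rpow_five_quarters (by positivity)]; ring
  by_cases h0 : s ≤ t 0
  · refine le_add_right (ENNReal.ofReal_le_ofReal ?_)
    calc s ^ (5 / 4 : ℝ) ≤ (t 0) ^ (5 / 4 : ℝ) := by gcongr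
      _ = _ := by rw [htp]; simp
  · have hex : ∃ n, s ≤ t n := by
      have hle : ∀ n : ℕ, (2 * ρ ^ 3) ^ 4 * n ≤ t n := fun n ↦ by
        have h1 : (n : ℝ) ≤ (2 ^ n) ^ 12 := by
          have : (n : ℝ) ≤ 2 ^ n := by exact_mod_cast Nat.lt_two_pow_self.le
          exact this.trans (le_self_pow₀ (one_le_pow₀ (by norm_num)) (by norm_num))
        calc _ ≤ (2 * ρ ^ 3) ^ 4 * (2 ^ n) ^ 12 := by gcongr
          _ = _ := by rw [ht]; ring
      obtain ⟨n, hn⟩ := exists_nat_ge (s / (2 * ρ ^ 3) ^ 4)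
      refine ⟨n, le_trans ?_ (hle n)⟩
      rwa [div_le_iff₀' (by positivity)] at hn
    obtain ⟨n, hn⟩ : ∃ n, Nat.find hex = n + 1 :=
      Nat.exists_eq_succ_of_ne_zero fun h ↦ h0 (h ▸ Nat.find_spec hex)
    have h1 : s ≤ t (n + 1) := hn ▸ Nat.find_spec hex
    have h2 : t n < s := not_le.1 (Nat.find_min hex (by omega))
    refine le_add_left (le_trans ?_ (ENNReal.le_tsum n))
    rw [if_pos h2]
    refine ENNReal.ofReal_le_ofReal ?_
    calc s ^ (5 / 4 : ℝ) ≤ (t (n + 1)) ^ (5 / 4 : ℝ) := by gcongr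
      _ = _ := by rw [htp]; ring

/-- The power `13/4` lies strictly between the exponent `2`, where the norm is fixed, and the
exponent `10/3`, where the gradient integral enters with a fixed factor, so that here the gradient
integral can be given an arbitrarily small factor. -/
theorem lintegral_rpow_le {ψ : L2} (h : ψ ∈ Xi) {ρ : ℝ} (hρ : 0 < ρ) :
    ∫⁻ x, ENNReal.ofReal (‖ψ x‖ ^ (13 / 4 : ℝ)) ≤
      ENNReal.ofReal (32 * ρ ^ 15 + 2 ^ 21 / ρ * ∫ x, gradSq ψ x) := by
  set K := ∫ x, gradSq ψ x with hK
  have hK0 : 0 ≤ K := integral_nonneg (gradSq_nonneg ψ)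
  have hmeas : Measurable fun x ↦ ‖ψ x‖ := (Lp.stronglyMeasurable ψ).norm.measurable
  have hme : Measurable fun x ↦ ‖ψ x‖ₑ ^ 2 := (Lp.stronglyMeasurable ψ).enorm.pow_const 2
  have hms : ∀ n : ℕ, MeasurableSet {x | (2 * (2 ^ n * ρ) ^ 3) ^ 4 < ‖ψ x‖} := fun n ↦
    measurableSet_lt measurable_const hmeas
  calc ∫⁻ x, ENNReal.ofReal (‖ψ x‖ ^ (13 / 4 : ℝ))
      ≤ ∫⁻ x, (ENNReal.ofReal (32 * ρ ^ 15) * ‖ψ x‖ₑ ^ 2 +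
          ∑' n : ℕ, ENNReal.ofReal (2 ^ 20 * (2 ^ n * ρ) ^ 15) *
            {x | (2 * (2 ^ n * ρ) ^ 3) ^ 4 < ‖ψ x‖}.indicator (fun x ↦ ‖ψ x‖ₑ ^ 2) x) := by
        refine lintegral_mono fun x ↦ ?_
        have e1 : ‖ψ x‖ ^ (13 / 4 : ℝ) = ‖ψ x‖ ^ (5 / 4 : ℝ) * ‖ψ x‖ ^ 2 := by
          rw [← rpow_natCast _ 2, ← rpow_add_of_nonneg (norm_nonneg _) (by norm_num) (by norm_num)]
          norm_num
        rw [e1, ENNReal.ofReal_mul (by positivity), ENNReal.ofReal_pow (norm_nonneg _), ofReal_norm]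
        grw [ofReal_rpow_le_tsum_indicator (norm_nonneg (ψ x)) hρ]
        rw [add_mul, ← ENNReal.tsum_mul_right]
        refine add_le_add le_rfl (ENNReal.tsum_le_tsum fun n ↦ ?_)
        by_cases hx : (2 * (2 ^ n * ρ) ^ 3) ^ 4 < ‖ψ x‖ <;> simp [hx]
    _ = ENNReal.ofReal (32 * ρ ^ 15) +
          ∑' n : ℕ, ENNReal.ofReal (2 ^ 20 * (2 ^ n * ρ) ^ 15) *
            ∫⁻ x in {x | (2 * (2 ^ n * ρ) ^ 3) ^ 4 < ‖ψ x‖}, ‖ψ x‖ₑ ^ 2 := by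
        rw [lintegral_add_left (hme.const_mul _), lintegral_const_mul _ hme,
          lintegral_enorm_sq_eq_one h, mul_one,
          lintegral_tsum fun n ↦ ((hme.indicator (hms n)).const_mul _).aemeasurable]
        congr 2
        ext n
        rw [lintegral_const_mul _ (hme.indicator (hms n)), lintegral_indicator (hms n)]
    _ ≤ ENNReal.ofReal (32 * ρ ^ 15) +
          ∑' n : ℕ, ENNReal.ofReal ((2 ^ 20 / ρ * K) * (1 / 2) ^ n) := by
        gcongr with n
        grw [setLIntegral_enorm_sq_le_of_lt_norm h (show 0 < 2 ^ n * ρ by positivity)]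
        rw [lintegral_ofReal_gradSq, ← ENNReal.ofReal_mul (by positivity),
          ← ENNReal.ofReal_mul (by positivity)]
        refine (congrArg ENNReal.ofReal ?_).le
        rw [← hK, one_div, inv_pow]
        field_simp
    _ = _ := by
        rw [← ENNReal.ofReal_tsum_of_nonneg (fun n ↦ by positivity)
          (summable_geometric_two.mul_left _), tsum_mul_left, tsum_geometric_two,
          ← ENNReal.ofReal_add (by positivity) (by positivity)]
        congr 1; ring

theorem integrable_norm_rpow {ψ : L2} (h : ψ ∈ Xi) :
    Integrable fun x ↦ ‖ψ x‖ ^ (13 / 4 : ℝ) := by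
  refine ⟨((Lp.stronglyMeasurable ψ).norm.measurable.pow_const _).aestronglyMeasurable, ?_⟩
  rw [hasFiniteIntegral_iff_ofReal (.of_forall fun x ↦ by positivity)]
  exact (lintegral_rpow_le h one_pos).trans_lt ENNReal.ofReal_lt_top

theorem integral_rpow_le {ψ : L2} (h : ψ ∈ Xi) {ρ : ℝ} (hρ : 0 < ρ) :
    ∫ x, ‖ψ x‖ ^ (13 / 4 : ℝ) ≤ 32 * ρ ^ 15 + 2 ^ 21 / ρ * ∫ x, gradSq ψ x := by
  have hK0 : 0 ≤ ∫ x, gradSq ψ x := integral_nonneg (gradSq_nonneg ψ)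
  rw [← ENNReal.ofReal_le_ofReal_iff (by positivity),
    ofReal_integral_eq_lintegral_ofReal (integrable_norm_rpow h)
      (.of_forall fun x ↦ by positivity)]
  exact lintegral_rpow_le h hρ

/-- Gagliardo–Nirenberg inequality in absorbed form. -/
theorem exists_forall_integral_rpow_le {δ : ℝ} (hδ : 0 < δ) :
    ∃ C : ℝ, ∀ ψ ∈ Xi, ∫ x, ‖ψ x‖ ^ (13 / 4 : ℝ) ≤ δ * (∫ x, gradSq ψ x) + C := by
  refine ⟨32 * (2 ^ 21 / δ) ^ 15, fun ψ h ↦ ?_⟩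
  have := integral_rpow_le h (show 0 < 2 ^ 21 / δ by positivity)
  rw [div_div_cancel₀ (by norm_num)] at this
  linarith

/-! ### Coulomb potentials -/

theorem integrableOn_norm_rpow_ball :
    IntegrableOn (fun y : R3 ↦ ‖y‖ ^ (-(13 / 5) : ℝ)) (Metric.ball 0 1) := by
  rw [integrableOn_fun_norm_addHaar volume (f := fun r : ℝ ↦ r ^ (-(13 / 5) : ℝ))]
  have h := (intervalIntegral.integrableOn_Ioo_rpow_iff (s := -(3 / 5)) zero_lt_one).2 (by norm_num)
  refine h.congr_fun (fun y hy ↦ ?_) measurableSet_Ioo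
  dsimp only
  rw [smul_eq_mul, finrank_euclideanSpace_fin, ← rpow_natCast, ← rpow_add hy.1]
  norm_num

/-- The integral of `|y|^{-13/5}` over the unit ball. -/
def ballConst : ℝ := ∫ y in Metric.ball (0 : R3) 1, ‖y‖ ^ (-(13 / 5) : ℝ)

theorem ballConst_nonneg : 0 ≤ ballConst := integral_nonneg fun y ↦ by positivity

/-- Within unit distance, either `s` is so large that `1 / r ≤ s ^ (5 / 4)`, or `s` is bounded by a
power of `r`. -/
theorem sq_div_le {s r : ℝ} (hs : 0 ≤ s) (hr : 0 ≤ r) :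
    s ^ 2 / r ≤ s ^ 2 + s ^ (13 / 4 : ℝ) + if r < 1 then r ^ (-(13 / 5) : ℝ) else 0 := by
  have e1 : s ^ (13 / 4 : ℝ) = s ^ 2 * s ^ (5 / 4 : ℝ) := by
    rw [← rpow_natCast _ 2, ← rpow_add_of_nonneg hs (by norm_num) (by norm_num)]
    norm_num
  have hs' : 0 ≤ s ^ (13 / 4 : ℝ) := by positivity
  rcases hr.eq_or_lt with rfl | hr0
  · -- division by zero gives zero on the left
    simp only [div_zero]; split_ifs <;> positivity
  split_ifs with h1
  · have hr' : 0 ≤ r ^ (-(13 / 5) : ℝ) := by positivity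
    by_cases h2 : r⁻¹ ≤ s ^ (5 / 4 : ℝ)
    · have : s ^ 2 / r ≤ s ^ (13 / 4 : ℝ) := by
        rw [e1, div_eq_mul_inv]; gcongr
      nlinarith [sq_nonneg s]
    · have h3 : s ≤ r ^ (-(4 / 5) : ℝ) := by
        have : (s ^ (5 / 4 : ℝ)) ^ (4 / 5 : ℝ) ≤ (r⁻¹) ^ (4 / 5 : ℝ) := by
          gcongr; exact (not_le.1 h2).le
        rw [← rpow_mul hs, inv_rpow hr, ← rpow_neg hr] at this
        norm_num at this ⊢; exact this
      have : s ^ 2 / r ≤ r ^ (-(13 / 5) : ℝ) := by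
        calc s ^ 2 / r ≤ (r ^ (-(4 / 5) : ℝ)) ^ 2 * r⁻¹ := by rw [div_eq_mul_inv]; gcongr
          _ = _ := by
            rw [← rpow_natCast, ← rpow_mul hr, ← rpow_neg_one r, ← rpow_add hr0]; norm_num
      nlinarith [sq_nonneg s]
  · have : s ^ 2 / r ≤ s ^ 2 := div_le_self (by positivity) (not_lt.1 h1)
    linarith

theorem coulomb_integrable_and_le {ψ : L2} (h : ψ ∈ Xi) (x : R3) :
    (Integrable fun y ↦ ‖ψ y‖ ^ 2 / ‖y - x‖) ∧
      ∫ y, ‖ψ y‖ ^ 2 / ‖y - x‖ ≤ 1 + (∫ y, ‖ψ y‖ ^ (13 / 4 : ℝ)) + ballConst := by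
  have hm : Measurable fun y ↦ ‖ψ y‖ := (Lp.stronglyMeasurable ψ).norm.measurable
  set w : R3 → ℝ := (Metric.ball 0 1).indicator fun y ↦ ‖y‖ ^ (-(13 / 5) : ℝ) with hw
  have hwi : Integrable w := integrableOn_norm_rpow_ball.integrable_indicator measurableSet_ball
  have hwx : Integrable fun y ↦ w (y - x) := hwi.comp_sub_right x
  have h1 := integrable_norm_sq ψ
  have h2 := integrable_norm_rpow h
  have hpt : ∀ y, ‖ψ y‖ ^ 2 / ‖y - x‖ ≤ ‖ψ y‖ ^ 2 + ‖ψ y‖ ^ (13 / 4 : ℝ) + w (y - x) := fun y ↦ by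
    have := sq_div_le (norm_nonneg (ψ y)) (norm_nonneg (y - x))
    by_cases hb : y - x ∈ Metric.ball (0 : R3) 1
    · rw [if_pos (mem_ball_zero_iff.1 hb)] at this
      rwa [hw, Set.indicator_of_mem hb]
    · rw [if_neg (mt mem_ball_zero_iff.2 hb)] at this
      rwa [hw, Set.indicator_of_notMem hb]
  have hint : Integrable fun y ↦ ‖ψ y‖ ^ 2 / ‖y - x‖ := by
    refine ((h1.add h2).add hwx).mono' ?_ (.of_forall fun y ↦ ?_)
    · exact ((hm.pow_const 2).div (by fun_prop)).aestronglyMeasurable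
    · rw [norm_of_nonneg (by positivity)]; exact hpt y
  refine ⟨hint, (integral_mono hint ((h1.add h2).add hwx) hpt).trans_eq ?_⟩
  rw [integral_add' (h1.add h2) hwx, integral_add' h1 h2, h.2, integral_sub_right_eq_self w x, hw,
    integral_indicator measurableSet_ball, ballConst]

/-! ### Interaction energies -/

/-- The integral of `|ψ|^{13/4}`, the quantity by which all negative contributions to the energies
are controlled. -/
def powerIntegral (ψ : L2) : ℝ := ∫ x, ‖ψ x‖ ^ (13 / 4 : ℝ)

theorem powerIntegral_nonneg (ψ : L2) : 0 ≤ powerIntegral ψ := integral_nonneg fun x ↦ by positivity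

theorem measurable_norm_coeFn (ψ : L2) : Measurable fun x ↦ ‖ψ x‖ :=
  (Lp.stronglyMeasurable ψ).norm.measurable

theorem abs_potential_le {ψ : L2} (h : ψ ∈ Xi) (q : ℝ) (x : R3) :
    |potential q ψ x| ≤ |q| * (1 + powerIntegral ψ + ballConst) := by
  rw [potential, abs_mul, abs_of_nonneg (integral_nonneg fun y ↦ by positivity)]
  gcongr
  exact (coulomb_integrable_and_le h x).2

theorem measurable_potential (q : ℝ) (ψ : L2) : Measurable (potential q ψ) := by
  have h : StronglyMeasurable (Function.uncurry fun x y : R3 ↦ ‖ψ y‖ ^ 2 / ‖y - x‖) := by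
    refine Measurable.stronglyMeasurable ?_
    have h1 : Measurable fun p : R3 × R3 ↦ ‖ψ p.2‖ := (measurable_norm_coeFn ψ).comp measurable_snd
    exact (h1.pow_const 2).div (by fun_prop)
  exact (h.integral_prod_right (ν := volume)).measurable.const_mul q

theorem measurable_interactionDensity {N : ℕ} (q : Fin N → ℝ) (ψ : Fin N → L2) (l : Fin N) :
    Measurable (interactionDensity q ψ l) := by
  have h : Measurable (potentialNe q ψ l) :=
    Finset.measurable_sum _ fun k _ ↦ measurable_potential _ _
  exact (((measurable_norm_coeFn (ψ l)).pow_const 2).const_mul _).mul h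

theorem abs_interactionDensity_le {N : ℕ} (q : Fin N → ℝ) {ψ : Fin N → L2} (h : ∀ l, ψ l ∈ Xi)
    (l : Fin N) (x : R3) :
    |interactionDensity q ψ l x| ≤
      (|q l| * ∑ k, |q k| * (1 + powerIntegral (ψ k) + ballConst)) * ‖ψ l x‖ ^ 2 := by
  have h1 : |potentialNe q ψ l x| ≤ ∑ k, |q k| * (1 + powerIntegral (ψ k) + ballConst) := by
    refine (Finset.abs_sum_le_sum_abs _ _).trans ((Finset.sum_le_sum fun k _ ↦
      abs_potential_le (h k) (q k) x).trans ?_)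
    refine Finset.sum_le_sum_of_subset_of_nonneg (Finset.erase_subset _ _) fun k _ _ ↦ ?_
    have := powerIntegral_nonneg (ψ k)
    have := ballConst_nonneg
    positivity
  rw [interactionDensity, abs_mul, abs_mul, abs_of_nonneg (sq_nonneg ‖ψ l x‖)]
  grw [h1]
  exact le_of_eq (by ring)

theorem integrable_interactionDensity {N : ℕ} (q : Fin N → ℝ) {ψ : Fin N → L2}
    (h : ∀ l, ψ l ∈ Xi) (l : Fin N) : Integrable (interactionDensity q ψ l) :=
  ((integrable_norm_sq (ψ l)).const_mul _).mono'
    (measurable_interactionDensity q ψ l).aestronglyMeasurable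
    (.of_forall fun x ↦ abs_interactionDensity_le q h l x)

theorem abs_integral_interactionDensity_le {N : ℕ} (q : Fin N → ℝ) {ψ : Fin N → L2}
    (h : ∀ l, ψ l ∈ Xi) (l : Fin N) :
    |∫ x, interactionDensity q ψ l x| ≤
      |q l| * ∑ k, |q k| * (1 + powerIntegral (ψ k) + ballConst) := by
  refine (norm_integral_le_of_norm_le (f := interactionDensity q ψ l)
    ((integrable_norm_sq (ψ l)).const_mul _)
    (.of_forall fun x ↦ abs_interactionDensity_le q h l x)).trans_eq ?_
  rw [integral_const_mul, (h l).2, mul_one]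

/-! ### The logarithmic nonlinearity -/

/-- `|ψ|² log⁻ |ψ|²`, the part of the logarithmic density that is large where `ψ` is small. -/
def entropyDensity (ψ : L2) (x : R3) : ℝ := ‖ψ x‖ ^ 2 * max (-log (‖ψ x‖ ^ 2)) 0

theorem entropyDensity_nonneg (ψ : L2) (x : R3) : 0 ≤ entropyDensity ψ x := by
  unfold entropyDensity; positivity

theorem measurable_entropyDensity (ψ : L2) : Measurable (entropyDensity ψ) := by
  have := measurable_norm_coeFn ψ
  unfold entropyDensity
  fun_prop

/-- The coefficient of the linear term of `-logG a`. -/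
def linearCoeff (a : ℝ) : ℝ := (a ^ 2)⁻¹ * (log (a ^ 3 / Cg ^ 2) + 2)

/-- The logarithm of the nonlinearity is dominated by a power for large `t`; the part for small `t`
has the favourable sign and is kept. -/
theorem logG_sq_ge {a t : ℝ} (ha : 0 < a) (ht : 0 ≤ t) :
    (a ^ 2)⁻¹ * (t ^ 2 * max (-log (t ^ 2)) 0) -
      ((a ^ 2)⁻¹ * (8 / 5) * t ^ (13 / 4 : ℝ) + |linearCoeff a| * t ^ 2) ≤ logG a (t ^ 2) := by
  rcases ht.eq_or_lt with rfl | ht0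
  · simp [logG_zero]
  have hC : 0 < Cg := by unfold Cg; positivity
  have e1 : log (a ^ 3 * t ^ 2 / Cg ^ 2) = log (a ^ 3 / Cg ^ 2) + log (t ^ 2) := by
    rw [← log_mul (by positivity) (by positivity)]; congr 1; ring
  have e2 : logG a (t ^ 2) = -(a ^ 2)⁻¹ * (t ^ 2 * log (t ^ 2)) - linearCoeff a * t ^ 2 := by
    rw [logG, e1, linearCoeff]; ring
  have e3 : t ^ (13 / 4 : ℝ) = t ^ 2 * t ^ (5 / 4 : ℝ) := by
    rw [← rpow_natCast _ 2, ← rpow_add_of_nonneg ht (by norm_num) (by norm_num)]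
    norm_num
  have h1 : log (t ^ 2) + max (-log (t ^ 2)) 0 ≤ 8 / 5 * t ^ (5 / 4 : ℝ) := by
    have h2 := log_le_rpow_div (sq_nonneg t) (show (0 : ℝ) < 5 / 8 by norm_num)
    have e4 : (t ^ 2) ^ (5 / 8 : ℝ) = t ^ (5 / 4 : ℝ) := by
      rw [← rpow_natCast, ← rpow_mul ht]; norm_num
    rw [e4] at h2
    rcases max_cases (-log (t ^ 2)) 0 with h | h <;> rw [h.1]
    · have : 0 ≤ t ^ (5 / 4 : ℝ) := by positivity
      linarith
    · linarith
  have h3 : linearCoeff a * t ^ 2 ≤ |linearCoeff a| * t ^ 2 := by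
    gcongr; exact le_abs_self _
  have h4 : (a ^ 2)⁻¹ * (t ^ 2 * (log (t ^ 2) + max (-log (t ^ 2)) 0)) ≤
      (a ^ 2)⁻¹ * (t ^ 2 * (8 / 5 * t ^ (5 / 4 : ℝ))) := by gcongr
  rw [e2, e3]
  linarith

/-- The non-negative density that the free energy dominates. -/
def freePos (χ m a : ℝ) (ψ : L2) (x : R3) : ℝ :=
  χ ^ 2 / (2 * m) * (gradSq ψ x + (a ^ 2)⁻¹ * entropyDensity ψ x)

/-- The integrable density that bounds the negative part of the free energy. -/
def freeNeg (χ m a : ℝ) (ψ : L2) (x : R3) : ℝ :=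
  χ ^ 2 / (2 * m) *
    ((a ^ 2)⁻¹ * (8 / 5) * ‖ψ x‖ ^ (13 / 4 : ℝ) + |linearCoeff a| * ‖ψ x‖ ^ 2)

theorem freePos_nonneg {χ m a : ℝ} (hm : 0 < m) (ψ : L2) (x : R3) : 0 ≤ freePos χ m a ψ x := by
  have := gradSq_nonneg ψ x
  have := entropyDensity_nonneg ψ x
  unfold freePos; positivity

theorem freePos_sub_freeNeg_le {χ m a : ℝ} (hm : 0 < m) (ha : 0 < a) (ψ : L2) (x : R3) :
    freePos χ m a ψ x - freeNeg χ m a ψ x ≤ freeDensity χ m a ψ x := by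
  have := logG_sq_ge ha (norm_nonneg (ψ x))
  rw [freePos, freeNeg, freeDensity, ← mul_sub, entropyDensity]
  gcongr
  linarith

theorem measurable_gradSq (ψ : L2) : Measurable (gradSq ψ) :=
  Finset.measurable_sum _ fun _ _ ↦ (measurable_norm_coeFn _).pow_const 2

theorem measurable_freePos (χ m a : ℝ) (ψ : L2) : Measurable (freePos χ m a ψ) :=
  ((measurable_gradSq ψ).add ((measurable_entropyDensity ψ).const_mul _)).const_mul _

theorem measurable_freeDensity (χ m a : ℝ) (ψ : L2) : Measurable (freeDensity χ m a ψ) := by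
  have h := measurable_norm_coeFn ψ
  have h' := measurable_gradSq ψ
  unfold freeDensity logG
  fun_prop

theorem integrable_freeNeg {ψ : L2} (h : ψ ∈ Xi) (χ m a : ℝ) : Integrable (freeNeg χ m a ψ) :=
  (((integrable_norm_rpow h).const_mul _).add ((integrable_norm_sq ψ).const_mul _)).const_mul _

theorem integral_freeNeg {ψ : L2} (h : ψ ∈ Xi) (χ m a : ℝ) : ∫ x, freeNeg χ m a ψ x =
    χ ^ 2 / (2 * m) * ((a ^ 2)⁻¹ * (8 / 5) * powerIntegral ψ + |linearCoeff a|) := by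
  unfold freeNeg
  rw [integral_const_mul, integral_add ((integrable_norm_rpow h).const_mul _)
    ((integrable_norm_sq ψ).const_mul _), integral_const_mul, integral_const_mul, h.2, mul_one,
    powerIntegral]

theorem lintegral_neg_le {f P n : R3 → ℝ} (hP : ∀ x, 0 ≤ P x) (hf : ∀ x, P x - n x ≤ f x) :
    ∫⁻ x, ENNReal.ofReal (-f x) ≤ ∫⁻ x, ENNReal.ofReal (n x) :=
  lintegral_mono fun x ↦ ENNReal.ofReal_le_ofReal (by linarith [hP x, hf x])

/-- A function with integrable negative part has the integral `⊤` or is integrable; in the latter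
case so is every non-negative `P` that it dominates up to an integrable function. -/
theorem eintegral_eq_top_or_exists_real {f P n : R3 → ℝ} (hfm : Measurable f) (hPm : Measurable P)
    (hP : ∀ x, 0 ≤ P x) (hn : Integrable n) (hf : ∀ x, P x - n x ≤ f x) :
    eintegral f = ⊤ ∨
      ∃ r : ℝ, eintegral f = r ∧ Integrable P ∧ (∫ x, P x) - ∫ x, n x ≤ r := by
  have hneg : ∫⁻ x, ENNReal.ofReal (-f x) ≠ ∞ :=
    ((lintegral_neg_le hP hf).trans_lt hn.lintegral_lt_top).ne
  by_cases htop : ∫⁻ x, ENNReal.ofReal (f x) = ∞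
  · left
    rw [eintegral, htop, ← ENNReal.ofReal_toReal hneg, EReal.coe_ennreal_ofReal,
      EReal.coe_ennreal_top, EReal.top_sub_coe]
  · right
    have hfi : Integrable f := by
      refine ⟨hfm.aestronglyMeasurable, ?_⟩
      have h1 : ∀ x, ‖f x‖ₑ ≤ ENNReal.ofReal (f x) + ENNReal.ofReal (-f x) := fun x ↦ by
        rw [← ofReal_norm, norm_eq_abs]
        rcases abs_cases (f x) with h | h <;> rw [h.1]
        · exact le_self_add
        · exact le_add_self
      refine (lintegral_mono h1).trans_lt ?_
      rw [lintegral_add_left hfm.ennreal_ofReal]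
      exact ENNReal.add_lt_top.2 ⟨lt_top_iff_ne_top.2 htop, lt_top_iff_ne_top.2 hneg⟩
    have hPi : Integrable P := by
      refine (hfi.add hn).mono' hPm.aestronglyMeasurable (.of_forall fun x ↦ ?_)
      rw [norm_of_nonneg (hP x)]
      exact sub_le_iff_le_add.1 (hf x)
    refine ⟨∫ x, f x, ?_, hPi, ?_⟩
    · rw [eintegral, integral_eq_lintegral_pos_part_sub_lintegral_neg_part hfi, EReal.coe_sub,
        EReal.coe_ennreal_toReal htop, EReal.coe_ennreal_toReal hneg]
    · rw [← integral_sub hPi hn]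
      exact integral_mono (hPi.sub hn) hfi hf

/-- Either the free energy is infinite, or the entropy is finite and the free energy is bounded
below by the gradient integral and the entropy, up to the term controlled by `powerIntegral`. -/
theorem freeEnergy_eq_top_or_exists_real {χ m a : ℝ} (hχ : 0 < χ) (hm : 0 < m) (ha : 0 < a)
    {ψ : L2} (h : ψ ∈ Xi) :
    eintegral (freeDensity χ m a ψ) = ⊤ ∨ ∃ r : ℝ, eintegral (freeDensity χ m a ψ) = r ∧
      Integrable (entropyDensity ψ) ∧
      χ ^ 2 / (2 * m) * ((∫ x, gradSq ψ x) + (a ^ 2)⁻¹ * ∫ x, entropyDensity ψ x) -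
        χ ^ 2 / (2 * m) * ((a ^ 2)⁻¹ * (8 / 5) * powerIntegral ψ + |linearCoeff a|) ≤ r := by
  refine (eintegral_eq_top_or_exists_real (measurable_freeDensity χ m a ψ)
    (measurable_freePos χ m a ψ) (freePos_nonneg hm ψ) (integrable_freeNeg h χ m a)
    (freePos_sub_freeNeg_le hm ha ψ)).imp_right ?_
  rintro ⟨r, hr, hP, hle⟩
  have hent : Integrable (entropyDensity ψ) := by
    refine (hP.const_mul ((χ ^ 2 / (2 * m))⁻¹ * a ^ 2)).mono'
      (measurable_entropyDensity ψ).aestronglyMeasurable (.of_forall fun x ↦ ?_)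
    rw [norm_of_nonneg (entropyDensity_nonneg ψ x), freePos]
    have : 0 ≤ a ^ 2 * gradSq ψ x := mul_nonneg (by positivity) (gradSq_nonneg ψ x)
    calc entropyDensity ψ x ≤ a ^ 2 * gradSq ψ x + entropyDensity ψ x := by linarith
      _ = _ := by field_simp
  refine ⟨r, hr, hent, ?_⟩
  rw [integral_freeNeg h] at hle
  unfold freePos at hle
  rwa [integral_const_mul, integral_add (integrable_gradSq ψ) (hent.const_mul _),
    integral_const_mul] at hle

/-! ### The Orlicz space -/

theorem orliczA_nonneg {s : ℝ} (hs : 0 ≤ s) : 0 ≤ orliczA s := by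
  unfold orliczA
  split_ifs with h
  · have h1 : s ≤ 1 := h.trans (exp_le_one_iff.2 (by norm_num))
    have := log_nonpos (sq_nonneg s) (pow_le_one₀ hs h1)
    nlinarith [sq_nonneg s]
  · have h1 : exp (-6) = exp (-3) * exp (-3) := by rw [← exp_add]; norm_num
    rw [h1]
    nlinarith [exp_pos (-3)]

theorem orliczA_le {s : ℝ} (hs : 0 ≤ s) : orliczA s ≤ 7 * s ^ 2 + s ^ 2 * max (-log (s ^ 2)) 0 := by
  have h0 : 0 ≤ s ^ 2 * max (-log (s ^ 2)) 0 := by positivity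
  unfold orliczA
  split_ifs with h
  · have : s ^ 2 * -log (s ^ 2) ≤ s ^ 2 * max (-log (s ^ 2)) 0 := by
      gcongr; exact le_max_left _ _
    nlinarith [sq_nonneg s]
  · nlinarith [exp_pos (-3), exp_pos (-6)]

/-- Dividing the argument by `k ≥ 1` gains `k⁻²` and costs only `2 log k` in the logarithm. -/
theorem orliczA_div_le {s k : ℝ} (hs : 0 ≤ s) (hk : 1 ≤ k) : orliczA (s / k) ≤
    (k ^ 2)⁻¹ * ((7 + 2 * log k) * s ^ 2 + s ^ 2 * max (-log (s ^ 2)) 0) := by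
  have hk0 : 0 < k := by linarith
  rcases hs.eq_or_lt with rfl | hs0
  · simp [orliczA, (exp_pos _).le]
  refine (orliczA_le (by positivity)).trans ?_
  have e1 : log ((s / k) ^ 2) = log (s ^ 2) - 2 * log k := by
    rw [div_pow, log_div (by positivity) (by positivity), log_pow k]; norm_num
  have hl := log_nonneg hk
  have h1 : max (-log ((s / k) ^ 2)) 0 ≤ max (-log (s ^ 2)) 0 + 2 * log k := by
    rw [e1]
    refine max_le ?_ (by positivity)
    linarith [le_max_left (-log (s ^ 2)) 0]
  grw [h1]
  refine le_of_eq ?_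
  field_simp
  ring

theorem measurable_orliczA : Measurable orliczA := by
  unfold orliczA
  exact Measurable.ite measurableSet_Iic (by fun_prop) (by fun_prop)

/-- Scaling by `k = 7 + ∫ |ψ|² log⁻ |ψ|²` brings the modular below `1`, since the factor `k⁻²` beats
the logarithm of `k`. -/
theorem mem_orliczX_and_normX_le {ψ : L2} (h : ψ ∈ Xi) (hent : Integrable (entropyDensity ψ)) :
    (ψ : R3 → ℂ) ∈ orliczX ∧
      normX ψ ≤ ENNReal.ofReal (7 + ∫ x, entropyDensity ψ x) := by
  have hm := measurable_norm_coeFn ψ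
  set I := ∫ x, entropyDensity ψ x with hI
  have hI0 : 0 ≤ I := integral_nonneg (entropyDensity_nonneg ψ)
  refine ⟨⟨locallyIntegrable_coeFn ψ, ?_⟩, ?_⟩
  · refine (((integrable_norm_sq ψ).const_mul 7).add hent).mono'
      (measurable_orliczA.comp hm).aestronglyMeasurable (.of_forall fun x ↦ ?_)
    rw [norm_of_nonneg (orliczA_nonneg (norm_nonneg _))]
    exact orliczA_le (norm_nonneg _)
  · have hk1 : 1 ≤ 7 + I := by linarith
    refine iInf₂_le_of_le (7 + I) (by linarith) (iInf_le_of_le ?_ le_rfl)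
    have hint : Integrable fun x ↦
        ((7 + I) ^ 2)⁻¹ * ((7 + 2 * log (7 + I)) * ‖ψ x‖ ^ 2 + entropyDensity ψ x) :=
      (((integrable_norm_sq ψ).const_mul _).add hent).const_mul _
    have hl := log_nonneg hk1
    calc ∫⁻ x, ENNReal.ofReal (orliczA (‖ψ x‖ / (7 + I)))
        ≤ ∫⁻ x, ENNReal.ofReal
            (((7 + I) ^ 2)⁻¹ * ((7 + 2 * log (7 + I)) * ‖ψ x‖ ^ 2 + entropyDensity ψ x)) :=
          lintegral_mono fun x ↦ ENNReal.ofReal_le_ofReal (orliczA_div_le (norm_nonneg _) hk1)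
      _ = ENNReal.ofReal (((7 + I) ^ 2)⁻¹ * ((7 + 2 * log (7 + I)) + I)) := by
          rw [← ofReal_integral_eq_lintegral_ofReal hint (.of_forall fun x ↦ ?_),
            integral_const_mul, integral_add ((integrable_norm_sq ψ).const_mul _) hent,
            integral_const_mul, h.2, mul_one]
          have := entropyDensity_nonneg ψ x
          positivity
      _ ≤ 1 := by
          rw [ENNReal.ofReal_le_one, inv_mul_le_iff₀ (by positivity)]
          have := log_le_sub_one_of_pos (show 0 < 7 + I by linarith)
          nlinarith

/-! ### Coercivity of the energies -/

theorem ereal_sum_ne_bot {ι : Type*} (s : Finset ι) {f : ι → EReal} (h : ∀ i ∈ s, f i ≠ ⊥) :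
    ∑ i ∈ s, f i ≠ ⊥ := by
  classical
  induction s using Finset.induction_on with
  | empty => simp
  | insert i s hi ih =>
    rw [Finset.sum_insert hi]
    exact EReal.add_ne_bot_iff.2 ⟨h i (by simp), ih fun j hj ↦ h j (by simp [hj])⟩

theorem ereal_sum_eq_top {ι : Type*} {s : Finset ι} {f : ι → EReal} (h : ∀ i ∈ s, f i ≠ ⊥)
    {i : ι} (hi : i ∈ s) (htop : f i = ⊤) : ∑ i ∈ s, f i = ⊤ := by
  classical
  rw [← Finset.add_sum_erase s f hi, htop]
  exact EReal.top_add_of_ne_bot (ereal_sum_ne_bot _ fun j hj ↦ h j (Finset.mem_of_mem_erase hj))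

theorem ereal_coe_sum {ι : Type*} (s : Finset ι) (f : ι → ℝ) :
    ((∑ i ∈ s, f i : ℝ) : EReal) = ∑ i ∈ s, (f i : EReal) :=
  map_sum (⟨⟨Real.toEReal, EReal.coe_zero⟩, EReal.coe_add⟩ : ℝ →+ EReal) f s

theorem eintegral_freeDensity_ne_bot {χ m a : ℝ} (hχ : 0 < χ) (hm : 0 < m) (ha : 0 < a)
    {ψ : L2} (h : ψ ∈ Xi) : eintegral (freeDensity χ m a ψ) ≠ ⊥ := by
  rcases freeEnergy_eq_top_or_exists_real hχ hm ha h with h | ⟨r, h, -⟩ <;> rw [h]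
  · exact bot_ne_top.symm
  · exact EReal.coe_ne_bot r

/-- The interactions `θ I` and the free energies `e` are bounded below jointly: the terms in
`powerIntegral` are absorbed into half of the gradient integrals. -/
theorem exists_sum_energy_ge {N : ℕ} {χ θ : ℝ} {m q a : Fin N → ℝ} (hχ : 0 < χ)
    (hm : ∀ l, 0 < m l) (hθ : 0 ≤ θ) (hθ1 : θ ≤ 1) :
    ∃ C : ℝ, ∀ ψ : Fin N → L2, (∀ l, ψ l ∈ Xi) → ∀ e : Fin N → ℝ,
      (∀ l, χ ^ 2 / (2 * m l) *
          ((∫ x, gradSq (ψ l) x) + (a l ^ 2)⁻¹ * ∫ x, entropyDensity (ψ l) x) -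
        χ ^ 2 / (2 * m l) * ((a l ^ 2)⁻¹ * (8 / 5) * powerIntegral (ψ l) + |linearCoeff (a l)|) ≤
          e l) →
      ∑ l, (χ ^ 2 / (2 * m l) / 2 * (∫ x, gradSq (ψ l) x) +
        χ ^ 2 / (2 * m l) * (a l ^ 2)⁻¹ * ∫ x, entropyDensity (ψ l) x) - C ≤
      ∑ l, (θ * (∫ x, interactionDensity q ψ l x) + e l) := by
  set c : Fin N → ℝ := fun l ↦ χ ^ 2 / (2 * m l) with hc
  have hc0 : ∀ l, 0 < c l := fun l ↦ by have := hm l; positivity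
  set S : ℝ := ∑ l, |q l| with hS
  have hS0 : 0 ≤ S := Finset.sum_nonneg fun _ _ ↦ abs_nonneg _
  -- the total coefficient of `powerIntegral (ψ l)`
  set β : Fin N → ℝ := fun l ↦ c l * ((a l ^ 2)⁻¹ * (8 / 5)) + S * |q l| with hβ
  have hβ0 : ∀ l, 0 ≤ β l := fun l ↦ by have := hc0 l; positivity
  choose D hD using fun l ↦ exists_forall_integral_rpow_le
    (show 0 < c l / (2 * (β l + 1)) from div_pos (hc0 l) (by linarith [hβ0 l]))
  refine ⟨∑ l, (β l * D l + c l * |linearCoeff (a l)| + S * (|q l| * (1 + ballConst))),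
    fun ψ hψ e he ↦ ?_⟩
  have hinter : -∑ l, S * (|q l| * (1 + powerIntegral (ψ l) + ballConst)) ≤
      ∑ l, θ * ∫ x, interactionDensity q ψ l x := by
    rw [← Finset.mul_sum]
    set T := ∑ l, |q l| * (1 + powerIntegral (ψ l) + ballConst) with hT
    rw [hS, Finset.sum_mul, ← Finset.sum_neg_distrib]
    refine Finset.sum_le_sum fun l _ ↦ ?_
    have h1 := abs_integral_interactionDensity_le q hψ l
    have h2 : |θ * ∫ x, interactionDensity q ψ l x| ≤ |∫ x, interactionDensity q ψ l x| := by
      rw [abs_mul, abs_of_nonneg hθ]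
      exact mul_le_of_le_one_left (abs_nonneg _) hθ1
    linarith [neg_abs_le (θ * ∫ x, interactionDensity q ψ l x)]
  rw [Finset.sum_add_distrib (f := fun l ↦ θ * ∫ x, interactionDensity q ψ l x)]
  refine le_trans ?_ (add_le_add_left hinter _)
  rw [neg_add_eq_sub, ← Finset.sum_sub_distrib, ← Finset.sum_sub_distrib]
  refine Finset.sum_le_sum fun l _ ↦ ?_
  have hK : 0 ≤ ∫ x, gradSq (ψ l) x := integral_nonneg (gradSq_nonneg _)
  have h1 : β l * powerIntegral (ψ l) ≤ c l / 2 * (∫ x, gradSq (ψ l) x) + β l * D l := by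
    have h2 := mul_le_mul_of_nonneg_left (hD l (ψ l) (hψ l)) (hβ0 l)
    have h3 : β l * (c l / (2 * (β l + 1))) ≤ c l / 2 := by
      have := hβ0 l
      have := hc0 l
      rw [← mul_div_assoc, div_le_div_iff₀ (by positivity) (by positivity)]
      nlinarith
    have h4 := mul_le_mul_of_nonneg_right h3 hK
    rw [mul_add, ← mul_assoc] at h2
    exact h2.trans (by linarith)
  have h5 := he l
  simp only [hβ] at h1 ⊢
  linarith

/-- Finiteness of the sum of the energies makes every free energy real, and then the energies are
coercive in the gradient integral and the entropy. -/
theorem exists_bounds_of_energy_le {N : ℕ} {χ θ : ℝ} {m q a : Fin N → ℝ} (hχ : 0 < χ)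
    (hm : ∀ l, 0 < m l) (ha : ∀ l, 0 < a l) (hθ : 0 ≤ θ) (hθ1 : θ ≤ 1) (M : ℝ) :
    ∃ C : ℝ, ∀ ψ : Fin N → L2, (∀ l, ψ l ∈ Xi) →
      ∑ l, (((θ * ∫ x, interactionDensity q ψ l x : ℝ) : EReal) +
        eintegral (freeDensity χ (m l) (a l) (ψ l))) ≤ (M : EReal) →
      ∀ l, normH1 (ψ l) ≤ C ∧ (ψ l : R3 → ℂ) ∈ orliczX ∧ normX (ψ l) ≤ ENNReal.ofReal C := by
  obtain ⟨C, hC⟩ := exists_sum_energy_ge (q := q) (a := a) hχ hm hθ hθ1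
  set c : Fin N → ℝ := fun l ↦ χ ^ 2 / (2 * m l) with hc
  have hc0 : ∀ l, 0 < c l := fun l ↦ by have := hm l; positivity
  set B : ℝ := |M + C| with hB
  -- the summands of the coercivity bound are non-negative, so each is at most `B`; this bounds the
  -- gradient integral and the entropy by the two terms of `b l`
  set b : Fin N → ℝ := fun l ↦ 2 * B / c l + a l ^ 2 * B / c l with hb
  have hb0 : ∀ l, 0 ≤ b l := fun l ↦ by have := hc0 l; positivity
  refine ⟨7 + ∑ l, b l, fun ψ hψ hM ↦ ?_⟩
  have hfree := fun l ↦ freeEnergy_eq_top_or_exists_real hχ (hm l) (ha l) (hψ l)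
  have hbot : ∀ l, ((θ * ∫ x, interactionDensity q ψ l x : ℝ) : EReal) +
      eintegral (freeDensity χ (m l) (a l) (ψ l)) ≠ ⊥ := fun l ↦
    EReal.add_ne_bot_iff.2
      ⟨EReal.coe_ne_bot _, eintegral_freeDensity_ne_bot hχ (hm l) (ha l) (hψ l)⟩
  have hreal := fun l ↦ (hfree l).resolve_left fun htop ↦ by
    rw [ereal_sum_eq_top (fun l _ ↦ hbot l) (Finset.mem_univ l)
      (by rw [htop, EReal.coe_add_top])] at hM
    exact (EReal.coe_lt_top M).not_ge hM
  choose e he hent hle using hreal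
  have hsum : ∑ l, (θ * (∫ x, interactionDensity q ψ l x) + e l) ≤ M := by
    simp_rw [he, ← EReal.coe_add] at hM
    rw [← ereal_coe_sum] at hM
    exact_mod_cast hM
  have hmain := hC ψ hψ e hle
  intro l
  have hK : ∀ l, 0 ≤ ∫ x, gradSq (ψ l) x := fun l ↦ integral_nonneg (gradSq_nonneg _)
  have hL : ∀ l, 0 ≤ ∫ x, entropyDensity (ψ l) x := fun l ↦
    integral_nonneg (entropyDensity_nonneg _)
  have hterm : c l / 2 * (∫ x, gradSq (ψ l) x) +
      c l * (a l ^ 2)⁻¹ * ∫ x, entropyDensity (ψ l) x ≤ B := by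
    refine (Finset.single_le_sum (f := fun l ↦ c l / 2 * (∫ x, gradSq (ψ l) x) +
      c l * (a l ^ 2)⁻¹ * ∫ x, entropyDensity (ψ l) x) (fun k _ ↦ ?_)
      (Finset.mem_univ l)).trans ?_
    · have := hc0 k; have := hK k; have := hL k; positivity
    · exact le_trans (by linarith) (le_abs_self _)
  have hcl := hc0 l
  have hal := ha l
  have hKl := hK l
  have hLl := hL l
  have hbl : b l ≤ ∑ l, b l := Finset.single_le_sum (fun k _ ↦ hb0 k) (Finset.mem_univ l)
  have hB0 : 0 ≤ B := abs_nonneg _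
  have h1 : 0 ≤ 2 * B / c l := by positivity
  have h2 : 0 ≤ a l ^ 2 * B / c l := by positivity
  have hKB : ∫ x, gradSq (ψ l) x ≤ 2 * B / c l := by
    rw [le_div_iff₀ hcl]
    have : 0 ≤ c l * (a l ^ 2)⁻¹ * ∫ x, entropyDensity (ψ l) x := by positivity
    linarith
  have hLB : ∫ x, entropyDensity (ψ l) x ≤ a l ^ 2 * B / c l := by
    rw [le_div_iff₀ hcl]
    have h3 : c l * (a l ^ 2)⁻¹ * ∫ x, entropyDensity (ψ l) x ≤ B := by
      have : 0 ≤ c l / 2 * ∫ x, gradSq (ψ l) x := by positivity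
      linarith
    calc (∫ x, entropyDensity (ψ l) x) * c l
        = a l ^ 2 * (c l * (a l ^ 2)⁻¹ * ∫ x, entropyDensity (ψ l) x) := by field_simp
      _ ≤ _ := by gcongr
  have hX := mem_orliczX_and_normX_le (hψ l) (hent l)
  simp only [hb] at hbl
  refine ⟨?_, hX.1, hX.2.trans (ENNReal.ofReal_le_ofReal (by linarith))⟩
  rw [normH1, (hψ l).2, sqrt_le_left (by linarith)]
  nlinarith

theorem exists_forall_le_totalEnergy {N : ℕ} {χ : ℝ} {m q a : Fin N → ℝ} (hχ : 0 < χ)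
    (hm : ∀ l, 0 < m l) (ha : ∀ l, 0 < a l) :
    ∃ c : ℝ, ∀ ψ : Fin N → L2, (∀ l, ψ l ∈ Xi) → (c : EReal) ≤ totalEnergy χ m q a ψ := by
  obtain ⟨C, hC⟩ := exists_sum_energy_ge (q := q) (a := a) hχ hm
    (show (0 : ℝ) ≤ 1 / 2 by norm_num) (by norm_num)
  refine ⟨-C, fun ψ hψ ↦ ?_⟩
  have hfree := fun l ↦ freeEnergy_eq_top_or_exists_real hχ (hm l) (ha l) (hψ l)
  have hbot : ∀ l, energyPart χ m q a ψ l ≠ ⊥ := fun l ↦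
    EReal.add_ne_bot_iff.2
      ⟨EReal.coe_ne_bot _, eintegral_freeDensity_ne_bot hχ (hm l) (ha l) (hψ l)⟩
  by_cases htop : ∃ l, eintegral (freeDensity χ (m l) (a l) (ψ l)) = ⊤
  · obtain ⟨l, hl⟩ := htop
    rw [totalEnergy, ereal_sum_eq_top (fun l _ ↦ hbot l) (Finset.mem_univ l)
      (by rw [energyPart, hl, EReal.coe_add_top])]
    exact le_top
  · push Not at htop
    choose e he hent hle using fun l ↦ (hfree l).resolve_left (htop l)
    have hmain := hC ψ hψ e hle
    simp_rw [totalEnergy, energyPart, he, ← EReal.coe_add]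
    rw [← ereal_coe_sum, EReal.coe_le_coe_iff]
    refine le_trans ?_ hmain
    have : 0 ≤ ∑ l, (χ ^ 2 / (2 * m l) / 2 * (∫ x, gradSq (ψ l) x) +
        χ ^ 2 / (2 * m l) * (a l ^ 2)⁻¹ * ∫ x, entropyDensity (ψ l) x) :=
      Finset.sum_nonneg fun l _ ↦ by
        have := hm l
        have : 0 ≤ ∫ x, gradSq (ψ l) x := integral_nonneg (gradSq_nonneg _)
        have : 0 ≤ ∫ x, entropyDensity (ψ l) x := integral_nonneg (entropyDensity_nonneg _)
        positivity
    linarith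

end WaveCorpuscle

end

open WaveCorpuscle

theorem mainTheorem12 (N : ℕ) (χ : ℝ) (m q a : Fin N → ℝ)
    (hχ : 0 < χ) (hm : ∀ l, 0 < m l) (ha : ∀ l, 0 < a l) :
    -- the energies are well defined on `Ξ^N`, with values in `(-∞, ∞]`
    (∀ ψ : Fin N → L2, (∀ l, ψ l ∈ Xi) → ∀ l,
      (∀ x : R3, Integrable fun y : R3 => ‖ψ l y‖ ^ 2 / ‖y - x‖) ∧
      Integrable (interactionDensity q ψ l) ∧
      ∫⁻ x, ENNReal.ofReal (-freeDensity χ (m l) (a l) (ψ l) x) < ∞) ∧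
    -- the total energy is bounded below on `Ξ^N`
    (∃ c : ℝ, ∀ ψ : Fin N → L2, (∀ l, ψ l ∈ Xi) → (c : EReal) ≤ totalEnergy χ m q a ψ) ∧
    -- boundedness of the total energy implies bounds in `H¹` and `X`
    (∀ M : ℝ, ∃ C : ℝ, ∀ ψ : Fin N → L2, (∀ l, ψ l ∈ Xi) →
      totalEnergy χ m q a ψ ≤ (M : EReal) →
      ∀ l, normH1 (ψ l) ≤ C ∧ (ψ l : R3 → ℂ) ∈ orliczX ∧ normX (ψ l) ≤ ENNReal.ofReal C) ∧
    -- boundedness of all the energies `𝖤_{0ℓ}` implies bounds in `H¹` and `X`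
    (∀ M : ℝ, ∃ C : ℝ, ∀ ψ : Fin N → L2, (∀ l, ψ l ∈ Xi) →
      (∀ l, energyInField χ m q a ψ l ≤ (M : EReal)) →
      ∀ l, normH1 (ψ l) ≤ C ∧ (ψ l : R3 → ℂ) ∈ orliczX ∧ normX (ψ l) ≤ ENNReal.ofReal C) := by
  refine ⟨fun ψ hψ l ↦ ⟨fun x ↦ (coulomb_integrable_and_le (hψ l) x).1,
    integrable_interactionDensity q hψ l, ?_⟩, exists_forall_le_totalEnergy hχ hm ha, fun M ↦ ?_,
    fun M ↦ ?_⟩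
  · exact (lintegral_neg_le (freePos_nonneg (hm l) (ψ l))
      (freePos_sub_freeNeg_le (hm l) (ha l) (ψ l))).trans_lt
        (integrable_freeNeg (hψ l) χ (m l) (a l)).lintegral_lt_top
  · exact exists_bounds_of_energy_le hχ hm ha (by norm_num) (by norm_num) M
  · obtain ⟨C, hC⟩ := exists_bounds_of_energy_le (q := q) hχ hm ha zero_le_one le_rfl (N * M)
    refine ⟨C, fun ψ hψ hM ↦ hC ψ hψ ?_⟩
    simp_rw [one_mul]
    refine (Finset.sum_le_sum fun l _ ↦ hM l).trans_eq ?_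
    rw [← ereal_coe_sum]
    simp
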